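/- Let $m\ge 2$. Identify a squarefree monomial $f$ in $x_0,\dots,x_{m-1}$ with its index set $\operatorname{ind}(f)\subseteq\{0,\dots,m-1\}$. Write $f\preceq_{sh} g$ if $f=x_{i_1}\cdots x_{i_s}$ and $g=x_{j_1}\cdots x_{j_s}$ (indices increasing) have the same degree and $i_\ell\le j_\ell$ for all $\ell$, and $f\preceq g$ if $f\preceq_{sh}g^*$ for some monomial $g^*\mid g$. A set $\mathcal I$ of squarefree monomials is decreasing if $f\in\mathcal I$ and $g\preceq f$ imply $g\in\mathcal I$. Its code $\mathcal C(\mathcal I)\subseteq\mathbb F_2^{2^m}$ is the span of the evaluation vectors $(f(x))_{x\in\mathbb F_2^m}$, $f\in\mathcal I$; $\mathcal R(r,m)$ is the code of all squarefree monomials of degree at most $r$; $|W_w|$ is the number of words of Hamming weight $w$ in $\mathcal C(\mathcal I)$; $\mathcal I_2$ is the set of monomials of degree $2$ in $\mathcal I$. Put $\lambda_f(x_i)=|\{j<i : j\notin\operatorname{ind}(f)\}|$ and $|\lambda_f|=\sum_{i\in\operatorname{ind}(f)}\lambda_f(x_i)$. For coprime $f,g$ of degree $2$ let $\alpha_{f,g}=2$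 if $f,g$ are not comparable for $\preceq$; if they are comparable, say $g\preceq f$, let $\alpha_{f,g}=1$ if the largest index of $g$ exceeds the smallest index of $f$, and $\alpha_{f,g}=0$ otherwise. **Theorem.** Let $\mathcal I$ be decreasing with $\mathcal R(1,m)\subseteq\mathcal C(\mathcal I)\subseteq\mathcal R(2,m)$. Then the complete weight distribution of $\mathcal C(\mathcal I)$ is as follows. 1. $|W_0|=|W_{2^m}|=1$. 2. $|W_{2^{m-2}}|=|W_{2^m-2^{m-2}}|=\sum_{f\in\mathcal I_2}2^{2+|\lambda_f|}$. 3. For every integer $\mu$ with $2\le 2\mu\le m$, $$|W_{2^{m-1}-2^{m-1-\mu}}|=|W_{2^{m-1}+2^{m-1-\mu}}|=\sum_{\{f_1,\dots,f_\mu\}}\frac{2^{2\mu+\sum_{i=1}^{\mu}|\lambda_{f_i}|}}{2^{\sum_{i<k}\alpha_{f_i,f_k}}},$$ the sum running over all sets of $\mu$ pairwise coprime monomials $f_1,\dots,f_\mu\in\mathcal I_2$. 4. $$|W_{2^{m-1}}|=\sum_{l=0}^{\lfloor (m-1)/2\rfloor}\ \sum_{(\{f_1,\dots,f_l\},\,x_j)}\frac{2^{2l+\sum_{i=1}^{l}|\lambda_{f_i}|+1+|\lambda_{f_1\cdots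 f_l}(x_j)|}}{2^{\sum_{i<k}\alpha_{f_i,f_k}}},$$ the inner sum running over all sets of $l$ pairwise coprime monomials $f_1,\dots,f_l\in\mathcal I_2$ together with a variable $x_j$ coprime to all of them (for $l=0$: the empty set with any $x_j$, $0\le j\le m-1$, and empty product $1$). Here $|\lambda_{f_1\cdots f_l}(x_j)|$ denotes the number $\lambda_{f_1\cdots f_l}(x_j)$. If $\mathcal C(\mathcal I)\ne\mathcal R(1,m)$, then $2^{m-1}$ is twice the minimum distance of $\mathcal C(\mathcal I)$. 5. $|W_w|=0$ for every other $w$. -/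

import Mathlib

/-- A squarefree monomial `x_{i_1} ⋯ x_{i_s}` in the variables `x_0, …, x_{m-1}`, given by its
index set `ind f = {i_1, …, i_s}`. Thus `f ∣ g` is `f ⊆ g`, the degree is `f.card`,
`gcd f g = f ∩ g`, and `gcd f g = 1` is `Disjoint f g`. -/
abbrev Mono (m : ℕ) : Type := Finset (Fin m)

namespace Mono

/-- The monomial as a polynomial over `𝔽₂`. -/
noncomputable def toPoly {m : ℕ} (f : Mono m) : MvPolynomial (Fin m) (ZMod 2) :=
  ∏ i ∈ f, MvPolynomial.X i

/-- `f ⪯_sh g`: the degrees agree and, both index sets being listed increasingly, the `ℓ`-th index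
of `f` is at most the `ℓ`-th index of `g` for every `ℓ`. -/
def LeSh {m : ℕ} (f g : Mono m) : Prop :=
  ∃ h : f.card = g.card, ∀ l : Fin g.card, f.orderEmbOfFin h l ≤ g.orderEmbOfFin rfl l

/-- `f ⪯ g`: there is a monomial `g'` with `f ⪯_sh g'` and `g' ∣ g`. -/
def Le {m : ℕ} (f g : Mono m) : Prop :=
  ∃ g' : Mono m, LeSh f g' ∧ g' ⊆ g

/-- `λ_f(x_i)`, the number of indices `j < i` outside `ind f`. -/
def lamVar {m : ℕ} (f : Mono m) (i : Fin m) : ℕ :=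
  (Finset.univ.filter fun j : Fin m => j < i ∧ j ∉ f).card

/-- `|λ_f| = ∑_{i ∈ ind f} λ_f(x_i)`. -/
def lam {m : ℕ} (f : Mono m) : ℕ :=
  ∑ i ∈ f, lamVar f i

/-- `g ⪯ f` and the largest index of `g` exceeds the smallest index of `f`. -/
def BelowOverlap {m : ℕ} (g f : Mono m) : Prop :=
  Le g f ∧ ∃ j ∈ g, ∃ i ∈ f, i < j

open Classical in
/-- The collision exponent `α_{f,g}` of two coprime monomials of degree two: `2` if they are not
comparable, `1` if they are comparable and the largest index of the smaller monomial exceeds the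
smallest index of the larger one, and `0` otherwise. -/
noncomputable def alpha {m : ℕ} (f g : Mono m) : ℕ :=
  if ¬ Le f g ∧ ¬ Le g f then 2
  else if BelowOverlap f g ∨ BelowOverlap g f then 1
  else 0

theorem alpha_comm {m : ℕ} (f g : Mono m) : alpha f g = alpha g f := by
  unfold alpha
  by_cases h₁ : Le f g <;> by_cases h₂ : Le g f <;> by_cases h₃ : BelowOverlap f g <;>
    by_cases h₄ : BelowOverlap g f <;> simp [h₁, h₂, h₃, h₄]

/-- `α` as a function of the unordered pair. -/
noncomputable def alphaPair {m : ℕ} : Sym2 (Mono m) → ℕ :=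
  Sym2.lift ⟨alpha, alpha_comm⟩

/-- The sum of `α_{f,g}` over the unordered pairs of distinct monomials `f, g` in `S`. -/
noncomputable def alphaSum {m : ℕ} (S : Finset (Mono m)) : ℕ :=
  ∑ p ∈ S.sym2.filter (fun p => ¬ p.IsDiag), alphaPair p

/-- A set of monomials is decreasing if it is downward closed for `⪯`. -/
def Decreasing {m : ℕ} (I : Finset (Mono m)) : Prop :=
  ∀ f ∈ I, ∀ g : Mono m, Le g f → g ∈ I

/-- `I_d`, the monomials of degree `d` in `I`. -/
def ofDegree {m : ℕ} (I : Finset (Mono m)) (d : ℕ) : Finset (Mono m) :=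
  I.filter fun f => f.card = d

open Classical in
/-- The sets `{f_1, …, f_μ} ⊆ I_2` of `μ` distinct pairwise coprime monomials of degree two. -/
noncomputable def coprimeTuples {m : ℕ} (I : Finset (Mono m)) (μ : ℕ) :
    Finset (Finset (Mono m)) :=
  ((ofDegree I 2).powersetCard μ).filter fun S => ∀ f ∈ S, ∀ g ∈ S, f ≠ g → Disjoint f g

/-- The product `f_1 ⋯ f_μ` of the pairwise coprime monomials in `S`. -/
def prod {m : ℕ} (S : Finset (Mono m)) : Mono m :=
  S.biUnion id

end Mono

/-- Binary words of length `2 ^ m`, with coordinates indexed by the points of `𝔽₂^m`. -/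
abbrev Word (m : ℕ) : Type := (Fin m → ZMod 2) → ZMod 2

/-- The word of all values of a polynomial in `m` variables over `𝔽₂`. -/
noncomputable def ev {m : ℕ} (P : MvPolynomial (Fin m) (ZMod 2)) : Word m :=
  fun x => MvPolynomial.eval x P

/-- The monomial code `C(I)`, spanned by the evaluations of the monomials in `I`. -/
noncomputable def monomialCode {m : ℕ} (I : Finset (Mono m)) : Submodule (ZMod 2) (Word m) :=
  Submodule.span (ZMod 2) {c | ∃ f ∈ I, ev f.toPoly = c}

/-- The Reed–Muller code `R(r, m)`, spanned by the evaluations of all monomials of degree at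
most `r`. -/
noncomputable def reedMuller (r m : ℕ) : Submodule (ZMod 2) (Word m) :=
  monomialCode (Finset.univ.filter fun f : Mono m => f.card ≤ r)

/-- `|W_w(C)|`, the number of words of Hamming weight `w` in `C`. -/
noncomputable def numWeight {m : ℕ} (C : Submodule (ZMod 2) (Word m)) (w : ℕ) : ℕ :=
  {c : Word m | c ∈ C ∧ hammingNorm c = w}.ncard

/-- The minimum distance of a code (which is also denoted by `w_min`). -/
noncomputable def minDistance {m : ℕ} (C : Submodule (ZMod 2) (Word m)) : ℕ :=
  sInf {d | ∃ c ∈ C, ∃ c' ∈ C, c ≠ c' ∧ hammingDist c c' = d}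

/-!
For a word `c` let `χ(c) = ∑ x, (-1) ^ c(x)`, so that the weight of `c` is `(2 ^ m - χ(c)) / 2`.
It suffices to determine how often each value of `χ` occurs, and this is done by eliminating
variables, for the codes of all monomials of `I` in a set `V` of variables.

Let `v` be the largest index in `V`, and write a word as `c = x_v L + c'` with `L`, `c'` free of
`x_v` and `L` affine (`sum_words_split`). If `L = 0`, then `x_v` can be dropped. If `L = 1`, then `c`
is balanced and `χ(c) = 0`. Otherwise `L = x_k + ℓ` with a leading variable `x_k`, where `ℓ` is
affine in the `x_i` with `i < k`; writing `c' = x_k ℓ' + r` gives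
`c = (x_v + ℓ') (x_k + ℓ) + (r + ℓ ℓ')`, whence `χ(c) = χ(r + ℓ ℓ') / 2` (`charSum_adjoin_adjoin`).
As `I` is decreasing and contains `x_k x_v`, the affine forms `ℓ`, `ℓ'` are arbitrary, and the
translation `r ↦ r + ℓ ℓ'` permutes the code in the remaining variables (`mul_mem_restr`). The number
of pairs `(ℓ, ℓ')` is `2 ^ (2 + |λ_{x_k x_v}|)`, with `λ` counted inside `V`.

The right-hand sides satisfy the same recursion (`sum_matchings`, `weight_insert`): a set of pairwise
coprime monomials of degree two is a matching, which either misses `v` or contains one edge `{k, v}`,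
and deleting `k` and `v` from `V` lowers the value of `|λ_f|` counted inside `V` by the number of
vertices of `f` above `k`, which is exactly the collision exponent `α` of `f` and `x_k x_v`
(`alpha_pair`). The outcome is `sum_words_eq_sum_matchings`, in which an arbitrary test function of
`χ` keeps track of all weights at once. For weight `2 ^ (m - 1)`, the number of balanced words that
belong to a matching is rewritten as a geometric sum over the unmatched variables
(`sum_variable_eq`).
-/

open Finset

/-! ### Monomial words and slices -/

theorem ev_toPoly_apply {m : ℕ} (f : Mono m) (x : Fin m → ZMod 2) :
    ev f.toPoly x = ∏ i ∈ f, x i := by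
  simp [ev, Mono.toPoly, map_prod]

theorem ev_toPoly_mem {m : ℕ} {J : Finset (Mono m)} {f : Mono m} (hf : f ∈ J) :
    ev f.toPoly ∈ monomialCode J :=
  Submodule.subset_span ⟨f, hf, rfl⟩

theorem monomialCode_le {m : ℕ} {J : Finset (Mono m)} {C : Submodule (ZMod 2) (Word m)}
    (h : ∀ f ∈ J, ev f.toPoly ∈ C) : monomialCode J ≤ C := by
  refine Submodule.span_le.2 ?_
  rintro _ ⟨f, hf, rfl⟩
  exact h f hf

/-- The word `c` with the coordinate `x_v` frozen at the value `a`. -/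
def slice {m : ℕ} (v : Fin m) (a : ZMod 2) : Word m →ₗ[ZMod 2] Word m where
  toFun c := fun x => c (Function.update x v a)
  map_add' _ _ := rfl
  map_smul' _ _ := rfl

theorem slice_apply {m : ℕ} (v : Fin m) (a : ZMod 2) (c : Word m) (x : Fin m → ZMod 2) :
    slice v a c x = c (Function.update x v a) := rfl

theorem slice_ev_of_notMem {m : ℕ} {v : Fin m} {f : Mono m} (hv : v ∉ f) (a : ZMod 2) :
    slice v a (ev f.toPoly) = ev f.toPoly := by
  funext x
  rw [slice_apply, ev_toPoly_apply, ev_toPoly_apply]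
  refine prod_congr rfl fun i hi => ?_
  rw [Function.update_of_ne]
  rintro rfl
  exact hv hi

theorem slice_ev_of_mem {m : ℕ} {v : Fin m} {f : Mono m} (hv : v ∈ f) (a : ZMod 2) :
    slice v a (ev f.toPoly) = a • ev (Mono.toPoly (f.erase v)) := by
  funext x
  rw [slice_apply, ev_toPoly_apply, ← mul_prod_erase _ _ hv, Function.update_self, Pi.smul_apply,
    smul_eq_mul, ev_toPoly_apply]
  congr 1
  refine prod_congr rfl fun i hi => ?_
  rw [Function.update_of_ne (ne_of_mem_erase hi)]

theorem slice_eq_self {m : ℕ} {v : Fin m} {J : Finset (Mono m)} (hJ : ∀ f ∈ J, v ∉ f)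
    {c : Word m} (hc : c ∈ monomialCode J) (a : ZMod 2) : slice v a c = c := by
  have : monomialCode J ≤ LinearMap.eqLocus (slice v a) LinearMap.id :=
    monomialCode_le fun f hf => slice_ev_of_notMem (hJ f hf) a
  exact this hc

theorem apply_update_of_mem {m : ℕ} {v : Fin m} {J : Finset (Mono m)} (hJ : ∀ f ∈ J, v ∉ f)
    {c : Word m} (hc : c ∈ monomialCode J) (x : Fin m → ZMod 2) (a : ZMod 2) :
    c (Function.update x v a) = c x :=
  congrFun (slice_eq_self hJ hc a) x

/-! ### Splitting a monomial code along a variable -/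

/-- The monomials `f / x_v` for the multiples `f` of `x_v` in `J`. -/
def link {m : ℕ} (v : Fin m) (J : Finset (Mono m)) : Finset (Mono m) :=
  (J.filter (v ∈ ·)).image (·.erase v)

theorem mem_link {m : ℕ} {v : Fin m} {J : Finset (Mono m)} {f : Mono m} :
    f ∈ link v J ↔ v ∉ f ∧ insert v f ∈ J := by
  simp only [link, mem_image, mem_filter]
  constructor
  · rintro ⟨g, ⟨hg, hv⟩, rfl⟩
    exact ⟨notMem_erase _ _, by rwa [insert_erase hv]⟩
  · rintro ⟨hv, hf⟩
    exact ⟨_, ⟨hf, mem_insert_self _ _⟩, erase_insert hv⟩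

/-- The monomials in `J` not divisible by `x_v`. -/
def deletion {m : ℕ} (v : Fin m) (J : Finset (Mono m)) : Finset (Mono m) :=
  J.filter (v ∉ ·)

theorem mem_deletion {m : ℕ} {v : Fin m} {J : Finset (Mono m)} {f : Mono m} :
    f ∈ deletion v J ↔ f ∈ J ∧ v ∉ f := by
  simp [deletion]

open Classical in
/-- The finite set of words of the monomial code of `J`. -/
noncomputable def words {m : ℕ} (J : Finset (Mono m)) : Finset (Word m) :=
  univ.filter (· ∈ monomialCode J)

theorem mem_words {m : ℕ} {J : Finset (Mono m)} {c : Word m} :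
    c ∈ words J ↔ c ∈ monomialCode J := by
  simp [words]

/-- The word `x_v L + c`. -/
def adjoin {m : ℕ} (v : Fin m) (L c : Word m) : Word m :=
  fun x => x v * L x + c x

theorem slice_zero_mem {m : ℕ} {v : Fin m} {J : Finset (Mono m)} {c : Word m}
    (hc : c ∈ monomialCode J) : slice v 0 c ∈ monomialCode (deletion v J) := by
  have : monomialCode J ≤ (monomialCode (deletion v J)).comap (slice v 0) := by
    refine monomialCode_le fun f hf => ?_
    rw [Submodule.mem_comap]
    by_cases hv : v ∈ f
    · rw [slice_ev_of_mem hv, zero_smul]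
      exact zero_mem _
    · rw [slice_ev_of_notMem hv]
      exact ev_toPoly_mem (mem_deletion.2 ⟨hf, hv⟩)
  exact this hc

theorem slice_sub_mem {m : ℕ} {v : Fin m} {J : Finset (Mono m)} {c : Word m}
    (hc : c ∈ monomialCode J) : slice v 1 c - slice v 0 c ∈ monomialCode (link v J) := by
  have : monomialCode J ≤ (monomialCode (link v J)).comap (slice v 1 - slice v 0) := by
    refine monomialCode_le fun f hf => ?_
    rw [Submodule.mem_comap, LinearMap.sub_apply]
    by_cases hv : v ∈ f
    · rw [slice_ev_of_mem hv, slice_ev_of_mem hv, zero_smul, one_smul, sub_zero]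
      exact ev_toPoly_mem (mem_link.2 ⟨notMem_erase _ _, by rwa [insert_erase hv]⟩)
    · rw [slice_ev_of_notMem hv, slice_ev_of_notMem hv, sub_self]
      exact zero_mem _
  exact this hc

theorem adjoin_mem {m : ℕ} {v : Fin m} {J : Finset (Mono m)} {L c : Word m}
    (hL : L ∈ monomialCode (link v J)) (hc : c ∈ monomialCode (deletion v J)) :
    adjoin v L c ∈ monomialCode J := by
  have h₁ : monomialCode (deletion v J) ≤ monomialCode J :=
    monomialCode_le fun f hf => ev_toPoly_mem (mem_deletion.1 hf).1
  let M : Word m →ₗ[ZMod 2] Word m :=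
    { toFun := fun L x => x v * L x
      map_add' := fun a b => funext fun x => mul_add _ _ _
      map_smul' := fun a b => funext fun x => mul_left_comm _ _ _ }
  have h₂ : monomialCode (link v J) ≤ (monomialCode J).comap M := by
    refine monomialCode_le fun f hf => ?_
    obtain ⟨hv, hf⟩ := mem_link.1 hf
    have : M (ev f.toPoly) = ev (Mono.toPoly (insert v f)) := by
      funext x
      rw [ev_toPoly_apply, prod_insert hv, ← ev_toPoly_apply]
      rfl
    rw [Submodule.mem_comap, this]
    exact ev_toPoly_mem hf
  exact add_mem (show M L ∈ monomialCode J from h₂ hL) (h₁ hc)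

theorem adjoin_slice {m : ℕ} (v : Fin m) (c : Word m) :
    adjoin v (slice v 1 c - slice v 0 c) (slice v 0 c) = c := by
  funext x
  have h : ∀ z : ZMod 2, z = 0 ∨ z = 1 := by decide
  have e : c (Function.update x v (x v)) = c x := by rw [Function.update_eq_self]
  simp only [adjoin, Pi.sub_apply, slice_apply]
  rcases h (x v) with hx | hx <;> rw [hx] at e ⊢ <;> linear_combination e

theorem sum_words_split {m : ℕ} (J : Finset (Mono m)) (v : Fin m) (F : Word m → ℚ) :
    ∑ c ∈ words J, F c =
      ∑ L ∈ words (link v J), ∑ c ∈ words (deletion v J), F (adjoin v L c) := by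
  rw [← sum_product']
  refine sum_nbij' (fun c => (slice v 1 c - slice v 0 c, slice v 0 c))
    (fun p => adjoin v p.1 p.2) ?_ ?_ ?_ ?_ ?_
  · intro c hc
    rw [mem_words] at hc
    exact mem_product.2 ⟨mem_words.2 (slice_sub_mem hc), mem_words.2 (slice_zero_mem hc)⟩
  · rintro ⟨L, c⟩ h
    obtain ⟨hL, hc⟩ := mem_product.1 h
    exact mem_words.2 (adjoin_mem (mem_words.1 hL) (mem_words.1 hc))
  · exact fun c _ => adjoin_slice v c
  · rintro ⟨L, c⟩ h
    obtain ⟨hL, hc⟩ := mem_product.1 h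
    have h₁ : ∀ x a, L (Function.update x v a) = L x :=
      apply_update_of_mem (fun f hf => (mem_link.1 hf).1) (mem_words.1 hL)
    have h₂ : ∀ x a, c (Function.update x v a) = c x :=
      apply_update_of_mem (fun f hf => (mem_deletion.1 hf).2) (mem_words.1 hc)
    refine Prod.ext ?_ ?_ <;> funext x <;>
      simp only [adjoin, Pi.sub_apply, slice_apply, Function.update_self] <;>
      simp only [h₁, h₂] <;> ring
  · exact fun c _ => congrArg F (adjoin_slice v c).symm

/-! ### Affine words -/

/-- The monomials of degree at most one in the variables from `K`; they span the affine
functions of these variables. -/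
def affMono {m : ℕ} (K : Finset (Fin m)) : Finset (Mono m) :=
  K.powerset.filter (·.card ≤ 1)

theorem mem_affMono {m : ℕ} {K : Finset (Fin m)} {f : Mono m} :
    f ∈ affMono K ↔ f ⊆ K ∧ f.card ≤ 1 := by
  simp [affMono]

theorem ev_toPoly_empty {m : ℕ} : ev (Mono.toPoly (∅ : Mono m)) = 1 := by
  funext x
  simp [ev_toPoly_apply]

theorem words_affMono_empty {m : ℕ} : words (affMono (∅ : Finset (Fin m))) = {0, 1} := by
  have h : affMono (∅ : Finset (Fin m)) = {∅} := by
    ext f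
    simp only [mem_affMono, subset_empty, mem_singleton]
    constructor
    · exact fun h => h.1
    · rintro rfl
      simp
  ext c
  have h2 : ∀ z : ZMod 2, z = 0 ∨ z = 1 := by decide
  have hs : {c : Word m | ∃ f ∈ ({∅} : Finset (Mono m)), ev f.toPoly = c} = {1} := by
    ext c
    simp [ev_toPoly_empty, eq_comm]
  rw [mem_words, h, monomialCode, hs, Submodule.mem_span_singleton, mem_insert, mem_singleton]
  constructor
  · rintro ⟨a, rfl⟩
    rcases h2 a with rfl | rfl <;> simp
  · rintro (rfl | rfl)
    · exact ⟨0, zero_smul _ _⟩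
    · exact ⟨1, one_smul _ _⟩

theorem link_affMono {m : ℕ} (K : Finset (Fin m)) (k : Fin m) :
    link k (affMono (insert k K)) = affMono ∅ := by
  ext f
  rw [mem_link, mem_affMono, mem_affMono]
  constructor
  · rintro ⟨hf, -, hc⟩
    rw [card_insert_of_notMem hf] at hc
    have : f = ∅ := card_eq_zero.1 (by omega)
    simp [this]
  · rintro ⟨hf, -⟩
    rw [subset_empty] at hf
    simp [hf]

theorem deletion_affMono {m : ℕ} {K : Finset (Fin m)} {k : Fin m} (hk : k ∉ K) :
    deletion k (affMono (insert k K)) = affMono K := by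
  ext f
  rw [mem_deletion, mem_affMono, mem_affMono]
  constructor
  · rintro ⟨⟨h, hc⟩, hf⟩
    exact ⟨(subset_insert_iff_of_notMem hf).1 h, hc⟩
  · rintro ⟨h, hc⟩
    exact ⟨⟨h.trans (subset_insert _ _), hc⟩, fun hf => hk (h hf)⟩

theorem sum_words_affMono_insert {m : ℕ} {K : Finset (Fin m)} {k : Fin m} (hk : k ∉ K)
    (G : Word m → ℚ) :
    ∑ L ∈ words (affMono (insert k K)), G L =
      ∑ L ∈ words (affMono K), G L + ∑ L ∈ words (affMono K), G (adjoin k 1 L) := by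
  rw [sum_words_split _ k, link_affMono K k, deletion_affMono hk, words_affMono_empty,
    sum_pair zero_ne_one]
  congr 1
  refine sum_congr rfl fun L _ => congrArg G ?_
  funext x
  simp [adjoin]

theorem card_words_affMono {m : ℕ} (K : Finset (Fin m)) :
    ((words (affMono K)).card : ℚ) = 2 ^ (K.card + 1) := by
  induction K using Finset.induction_on with
  | empty => simp [words_affMono_empty]
  | insert k K hk ih =>
    have := sum_words_affMono_insert hk (fun _ => (1 : ℚ))
    simp only [sum_const, nsmul_eq_mul, mul_one, ih] at this
    rw [this, card_insert_of_notMem hk]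
    ring

/-- An affine word is `0`, or `1`, or has a leading variable. -/
theorem sum_words_affMono {m : ℕ} (K : Finset (Fin m)) (G : Word m → ℚ) :
    ∑ L ∈ words (affMono K), G L =
      G 0 + G 1 + ∑ k ∈ K, ∑ L ∈ words (affMono (K.filter (· < k))), G (adjoin k 1 L) := by
  induction K using Finset.induction_on_max with
  | empty => simp [words_affMono_empty]
  | insert k K hK ih =>
    have hk : k ∉ K := fun h => lt_irrefl _ (hK k h)
    have h₁ : (insert k K).filter (· < k) = K := by
      ext i
      simp only [mem_filter, mem_insert]
      constructor
      · rintro ⟨rfl | h, h'⟩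
        · exact absurd h' (lt_irrefl _)
        · exact h
      · exact fun h => ⟨Or.inr h, hK i h⟩
    have h₂ : ∀ i ∈ K, (insert k K).filter (· < i) = K.filter (· < i) := fun i hi => by
      rw [filter_insert, if_neg (hK i hi).not_gt]
    have h₃ : ∑ i ∈ K, ∑ L ∈ words (affMono ((insert k K).filter (· < i))), G (adjoin i 1 L) =
        ∑ i ∈ K, ∑ L ∈ words (affMono (K.filter (· < i))), G (adjoin i 1 L) :=
      sum_congr rfl fun i hi => by rw [h₂ i hi]
    rw [sum_words_affMono_insert hk, ih, sum_insert hk, h₁, h₃]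
    ring

/-! ### Character sums -/

/-- The character `z ↦ (-1) ^ z` of `𝔽₂`. -/
def sgn (z : ZMod 2) : ℤ := if z = 0 then 1 else -1

/-- The character sum `∑ x, (-1) ^ c(x)` of a word; it determines the weight. -/
def charSum {m : ℕ} (c : Word m) : ℚ := ∑ x, (sgn (c x) : ℚ)

theorem charSum_eq {m : ℕ} (c : Word m) : charSum c = 2 ^ m - 2 * hammingNorm c := by
  have h : ∀ z : ZMod 2, (sgn z : ℚ) = 1 - 2 * (if z ≠ 0 then 1 else 0) := by
    intro z
    by_cases hz : z = 0 <;> simp [sgn, hz]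
    norm_num
  simp only [charSum, h, sum_sub_distrib, ← mul_sum, sum_boole, hammingNorm]
  simp

theorem charSum_zero {m : ℕ} : charSum (0 : Word m) = 2 ^ m := by
  simp [charSum_eq]

theorem charSum_one {m : ℕ} : charSum (1 : Word m) = -2 ^ m := by
  simp [charSum, sgn]

theorem sum_flip {m : ℕ} (v : Fin m) (h : (Fin m → ZMod 2) → ℚ) :
    ∑ x, h (Function.update x v (x v + 1)) = ∑ x, h x := by
  have h2 : ∀ z : ZMod 2, z + 1 + 1 = z := by decide
  refine sum_nbij' (fun x => Function.update x v (x v + 1)) (fun x => Function.update x v (x v + 1))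
    ?_ ?_ ?_ ?_ ?_ <;> simp [h2]

theorem charSum_adjoin_one {m : ℕ} {v : Fin m} {J : Finset (Mono m)} (hJ : ∀ f ∈ J, v ∉ f)
    {c : Word m} (hc : c ∈ monomialCode J) : charSum (adjoin v 1 c) = 0 := by
  have h₁ : charSum (adjoin v 1 c) = -charSum (adjoin v 1 c) := by
    conv_lhs => rw [charSum, ← sum_flip v]
    rw [charSum, ← sum_neg_distrib]
    refine sum_congr rfl fun x _ => ?_
    simp only [adjoin, apply_update_of_mem hJ hc, Function.update_self, Pi.one_apply, mul_one]
    generalize x v = a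
    generalize c x = b
    have key : ∀ a b : ZMod 2, sgn (a + 1 + b) = -sgn (a + b) := by decide
    exact_mod_cast key a b
  linarith

/-- If `ℓ`, `ℓ'` and `r` do not involve `x_v` and `x_k`, then
`x_v (x_k + ℓ) + x_k ℓ' + r = (x_v + ℓ') (x_k + ℓ) + (r + ℓ ℓ')`. For fixed values of the other
variables the product vanishes at three of the four choices of `(x_v, x_k)`, so the four signs add up
to twice the sign of `r + ℓ ℓ'`. -/
theorem charSum_adjoin_adjoin {m : ℕ} {v k : Fin m} (hvk : v ≠ k) {J₁ J₂ J₃ : Finset (Mono m)}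
    (h₁ : ∀ f ∈ J₁, v ∉ f ∧ k ∉ f) (h₂ : ∀ f ∈ J₂, v ∉ f ∧ k ∉ f) (h₃ : ∀ f ∈ J₃, v ∉ f ∧ k ∉ f)
    {l l' r : Word m} (hl : l ∈ monomialCode J₁) (hl' : l' ∈ monomialCode J₂)
    (hr : r ∈ monomialCode J₃) :
    charSum (adjoin v (adjoin k 1 l) (adjoin k l' r)) = charSum (r + l * l') / 2 := by
  set c := adjoin v (adjoin k 1 l) (adjoin k l' r)
  have e₁ : charSum c = ∑ x, (sgn (c (Function.update x v (x v + 1))) : ℚ) := (sum_flip v _).symm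
  have e₂ : charSum c = ∑ x, (sgn (c (Function.update x k (x k + 1))) : ℚ) :=
    (sum_flip k fun x => (sgn (c x) : ℚ)).symm
  have e₃ : charSum c = 
      ∑ x, (sgn (c (Function.update (Function.update x k (x k + 1)) v (x v + 1))) : ℚ) := by
    rw [e₁, ← sum_flip k]
    refine sum_congr rfl fun x _ => ?_
    rw [Function.update_of_ne hvk]
  have e : 4 * charSum c = 2 * charSum (r + l * l') := by
    calc 4 * charSum c = charSum c + charSum c + charSum c + charSum c := by ring
      _ = _ := by
        nth_rw 1 [e₁]
        nth_rw 1 [e₂]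
        nth_rw 1 [e₃]
        rw [charSum, charSum, ← sum_add_distrib, ← sum_add_distrib, ← sum_add_distrib, mul_sum]
        refine sum_congr rfl fun x _ => ?_
        simp only [c, adjoin, Pi.add_apply, Pi.mul_apply, Pi.one_apply, mul_one,
          apply_update_of_mem (fun f hf => (h₁ f hf).1) hl,
          apply_update_of_mem (fun f hf => (h₂ f hf).1) hl',
          apply_update_of_mem (fun f hf => (h₃ f hf).1) hr,
          apply_update_of_mem (fun f hf => (h₁ f hf).2) hl,
          apply_update_of_mem (fun f hf => (h₂ f hf).2) hl',
          apply_update_of_mem (fun f hf => (h₃ f hf).2) hr,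
          Function.update_self, Function.update_of_ne hvk, Function.update_of_ne hvk.symm]
        generalize x v = a
        generalize x k = b
        generalize l x = p
        generalize l' x = q
        generalize r x = s
        have key : ∀ a b p q s : ZMod 2,
            sgn ((a + 1) * (b + p) + (b * q + s)) + sgn (a * (b + 1 + p) + ((b + 1) * q + s)) +
              sgn ((a + 1) * (b + 1 + p) + ((b + 1) * q + s)) + sgn (a * (b + p) + (b * q + s)) =
            2 * sgn (s + p * q) := by decide
        exact_mod_cast key a b p q s
  linarith

/-! ### The order and the collision exponent on edges -/

theorem pair_le_pair_iff {m : ℕ} {a b c d : Fin m} (hab : a < b) (hcd : c < d) :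
    Mono.Le {a, b} {c, d} ↔ a ≤ c ∧ b ≤ d := by
  have h₁ : ({a, b} : Mono m).card = 2 := card_pair hab.ne
  have h₂ : ({c, d} : Mono m).card = 2 := card_pair hcd.ne
  have key : ∀ {a b : Fin m} (hab : a < b) {n : ℕ} (h : ({a, b} : Mono m).card = n) (l : Fin n),
      Finset.orderEmbOfFin _ h l = if l.1 = 0 then a else b := by
    intro a b hab n h l
    obtain rfl : n = 2 := by rw [← h, card_pair hab.ne]
    have hu := Finset.orderEmbOfFin_unique h (f := fun l : Fin 2 => if l.1 = 0 then a else b)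
      (by intro x; split_ifs <;> simp)
      (by
        intro x y hxy
        have hx : x.1 = 0 := by have := x.2; have := y.2; rw [Fin.lt_def] at hxy; omega
        have hy : y.1 ≠ 0 := by rw [Fin.lt_def] at hxy; omega
        simpa [hx, hy] using hab)
    exact (congrFun hu l).symm
  constructor
  · rintro ⟨g, ⟨hc, hl⟩, hg⟩
    obtain rfl : g = {c, d} := eq_of_subset_of_card_le hg (by omega)
    have h0 := hl ⟨0, by omega⟩
    have h1 := hl ⟨1, by omega⟩
    rw [key hab, key hcd] at h0 h1
    exact ⟨by simpa using h0, by simpa using h1⟩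
  · rintro ⟨hac, hbd⟩
    refine ⟨{c, d}, ⟨h₁.trans h₂.symm, fun l => ?_⟩, subset_rfl⟩
    rw [key hab, key hcd]
    split_ifs
    · exact hac
    · exact hbd

theorem exists_lt_of_card_eq_two {m : ℕ} {f : Mono m} (hf : f.card = 2) :
    ∃ a b, a < b ∧ f = {a, b} := by
  obtain ⟨a, b, hab, rfl⟩ := card_eq_two.1 hf
  rcases hab.lt_or_gt with h | h
  · exact ⟨a, b, h, rfl⟩
  · exact ⟨b, a, h, pair_comm a b⟩

/-- Against an edge `{k, v}` with `v` above everything else, the collision exponent of `f` counts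
the vertices of `f` above `k`. -/
theorem alpha_pair {m : ℕ} {f : Mono m} {k v : Fin m} (hf : f.card = 2) (hkv : k < v)
    (hv : ∀ i ∈ f, i < v) (hk : k ∉ f) :
    Mono.alpha {k, v} f = (f.filter (k < ·)).card := by
  obtain ⟨a, b, hab, rfl⟩ := exists_lt_of_card_eq_two hf
  have ha : a < v := hv a (by simp)
  have hb : b < v := hv b (by simp)
  have hka : k ≠ a := fun h => hk (by simp [h])
  have hkb : k ≠ b := fun h => hk (by simp [h])
  have h₁ : ¬ Mono.Le {k, v} {a, b} := fun h =>
    absurd ((pair_le_pair_iff hkv hab).1 h).2 hb.not_ge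
  have h₂ : Mono.Le {a, b} {k, v} ↔ a < k := by
    rw [pair_le_pair_iff hab hkv]
    exact ⟨fun h => lt_of_le_of_ne h.1 hka.symm, fun h => ⟨h.le, hb.le⟩⟩
  have h₃ : Mono.BelowOverlap {a, b} {k, v} ↔ a < k ∧ k < b := by
    rw [Mono.BelowOverlap, h₂]
    refine and_congr_right fun hak => ?_
    simp only [mem_insert, mem_singleton, exists_eq_or_imp, exists_eq_left]
    constructor
    · rintro ((h | h) | (h | h))
      · exact absurd h hak.not_gt
      · exact absurd h ha.not_gt
      · exact h
      · exact absurd h hb.not_gt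
    · exact fun h => Or.inr (Or.inl h)
  have h₄ : ¬ Mono.BelowOverlap {k, v} {a, b} := fun h => h₁ h.1
  unfold Mono.alpha
  rw [filter_insert, filter_singleton]
  simp only [h₁, h₂, h₃, h₄, not_false_eq_true, true_and, false_or]
  rcases hka.lt_or_gt with h | h
  · have h' := h.trans hab
    simp [h.not_gt, h, h', hab.ne]
  · rcases hkb.lt_or_gt with h' | h'
    · simp [h, h', h.not_gt]
    · simp [h, h'.not_gt, h.not_gt]

theorem alphaSum_insert {m : ℕ} {S : Finset (Mono m)} {f : Mono m} (hf : f ∉ S) :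
    Mono.alphaSum (insert f S) = Mono.alphaSum S + ∑ g ∈ S, Mono.alpha f g := by
  have h : (insert f S).sym2.filter (fun p => ¬ p.IsDiag) =
      S.sym2.filter (fun p => ¬ p.IsDiag) ∪ S.image (fun g => s(f, g)) := by
    ext p
    induction p using Sym2.ind with
    | _ a b =>
      simp only [mem_filter, mk_mem_sym2_iff, mem_insert, Sym2.mk_isDiag_iff, mem_union, mem_image,
        Sym2.eq_iff]
      constructor
      · rintro ⟨⟨rfl | ha, rfl | hb⟩, hab⟩
        · exact absurd rfl hab
        · exact Or.inr ⟨b, hb, Or.inl ⟨rfl, rfl⟩⟩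
        · exact Or.inr ⟨a, ha, Or.inr ⟨rfl, rfl⟩⟩
        · exact Or.inl ⟨⟨ha, hb⟩, hab⟩
      · rintro (⟨⟨ha, hb⟩, hab⟩ | ⟨g, hg, ⟨rfl, rfl⟩ | ⟨rfl, rfl⟩⟩)
        · exact ⟨⟨Or.inr ha, Or.inr hb⟩, hab⟩
        · exact ⟨⟨Or.inl rfl, Or.inr hg⟩, fun h => hf (h ▸ hg)⟩
        · exact ⟨⟨Or.inr hg, Or.inl rfl⟩, fun h => hf (h ▸ hg)⟩
  rw [Mono.alphaSum, h, sum_union, sum_image]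
  · rfl
  · intro a _ b _ hab
    exact Sym2.congr_right.1 hab
  · rw [disjoint_left]
    intro p hp hp'
    obtain ⟨g, hg, rfl⟩ := mem_image.1 hp'
    exact hf (mk_mem_sym2_iff.1 (mem_filter.1 hp).1).1

/-! ### Matchings inside a set of variables -/

/-- The monomials of `I` in the variables from `V`. -/
def restr {m : ℕ} (I : Finset (Mono m)) (V : Finset (Fin m)) : Finset (Mono m) :=
  I.filter (· ⊆ V)

theorem mem_restr {m : ℕ} {I : Finset (Mono m)} {V : Finset (Fin m)} {f : Mono m} :
    f ∈ restr I V ↔ f ∈ I ∧ f ⊆ V := by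
  simp [restr]

open Classical in
/-- The sets of pairwise coprime monomials of degree two of `I` in the variables from `V`: the
partial matchings of `V` with edges in `I`. -/
noncomputable def matchings {m : ℕ} (I : Finset (Mono m)) (V : Finset (Fin m)) :
    Finset (Finset (Mono m)) :=
  (Mono.ofDegree (restr I V) 2).powerset.filter fun S => ∀ f ∈ S, ∀ g ∈ S, f ≠ g → Disjoint f g

theorem mem_matchings {m : ℕ} {I : Finset (Mono m)} {V : Finset (Fin m)} {S : Finset (Mono m)} :
    S ∈ matchings I V ↔ (∀ f ∈ S, f ∈ I ∧ f ⊆ V ∧ f.card = 2) ∧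
      ∀ f ∈ S, ∀ g ∈ S, f ≠ g → Disjoint f g := by
  simp [matchings, Mono.ofDegree, subset_iff, mem_restr, and_assoc]

/-- `|λ_f|` counted inside the set of variables `V`. -/
def lamIn {m : ℕ} (V : Finset (Fin m)) (f : Mono m) : ℕ :=
  ∑ i ∈ f, (V.filter fun j => j < i ∧ j ∉ f).card

theorem lamIn_univ {m : ℕ} (f : Mono m) : lamIn univ f = f.lam := rfl

theorem lamIn_erase {m : ℕ} {V : Finset (Fin m)} {v : Fin m} (hv : ∀ i ∈ V, i ≤ v) {f : Mono m}
    (hf : f ⊆ V) : lamIn V f = lamIn (V.erase v) f := by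
  refine sum_congr rfl fun i hi => congrArg card ?_
  ext j
  simp only [mem_filter, mem_erase]
  constructor
  · exact fun h => ⟨⟨(h.2.1.trans_le (hv i (hf hi))).ne, h.1⟩, h.2⟩
  · exact fun h => ⟨h.1.2, h.2⟩

theorem lamIn_pair {m : ℕ} {V : Finset (Fin m)} {v k : Fin m} (hv : ∀ i ∈ V, i ≤ v) (hkv : k < v) :
    lamIn V {k, v} = (V.filter (· < k)).card + ((V.erase v).erase k).card := by
  rw [lamIn, sum_pair hkv.ne]
  congr 2
  · ext j
    simp only [mem_filter, mem_insert, mem_singleton, not_or]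
    exact and_congr_right fun _ => ⟨fun h => h.1, fun h => ⟨h, h.ne, (h.trans hkv).ne⟩⟩
  · ext j
    simp only [mem_filter, mem_insert, mem_singleton, not_or, mem_erase]
    constructor
    · exact fun h => ⟨h.2.2.1, h.2.2.2, h.1⟩
    · exact fun h => ⟨h.2.2, lt_of_le_of_ne (hv j h.2.2) h.2.1, h.1, h.2.1⟩

/-- Deleting the edge `{k, v}` with `v` maximal lowers `|λ_f|` by the collision exponent. -/
theorem lamIn_erase_erase {m : ℕ} {V : Finset (Fin m)} {v k : Fin m} (hv : ∀ i ∈ V, i ≤ v)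
    (hk : k ∈ V) (hkv : k < v) {f : Mono m} (hf : f ⊆ (V.erase v).erase k) (hf2 : f.card = 2) :
    lamIn V f = lamIn ((V.erase v).erase k) f + Mono.alpha {k, v} f := by
  have hf' : f ⊆ V.erase v := hf.trans (erase_subset _ _)
  have hkf : k ∉ f := fun h => notMem_erase _ _ (hf h)
  have hlt : ∀ i ∈ f, i < v := fun i hi =>
    lt_of_le_of_ne (hv i (mem_of_mem_erase (hf' hi))) (ne_of_mem_erase (hf' hi))
  rw [lamIn_erase hv (hf'.trans (erase_subset _ _)), alpha_pair hf2 hkv hlt hkf, card_filter, lamIn,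
    lamIn, ← sum_add_distrib]
  refine sum_congr rfl fun i _ => ?_
  have hk' : k ∈ V.erase v := mem_erase.2 ⟨hkv.ne, hk⟩
  conv_lhs => rw [← insert_erase hk', filter_insert]
  by_cases h : k < i
  · rw [if_pos ⟨h, hkf⟩, if_pos h, card_insert_of_notMem (by simp)]
  · rw [if_neg (fun h' => h h'.1), if_neg h, add_zero]

/-- The contribution `2 ^ (2 |S| + ∑ |λ_f|) / 2 ^ ∑ α` of a matching `S`, counted inside `V`. -/
noncomputable def weight {m : ℕ} (V : Finset (Fin m)) (S : Finset (Mono m)) : ℚ :=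
  2 ^ (2 * S.card + ∑ f ∈ S, lamIn V f) / 2 ^ Mono.alphaSum S

theorem weight_erase {m : ℕ} {I : Finset (Mono m)} {V : Finset (Fin m)} {v : Fin m}
    (hv : ∀ i ∈ V, i ≤ v) {S : Finset (Mono m)} (hS : S ∈ matchings I (V.erase v)) :
    weight V S = weight (V.erase v) S := by
  rw [weight, weight, sum_congr rfl fun f hf =>
    lamIn_erase hv (((mem_matchings.1 hS).1 f hf).2.1.trans (erase_subset _ _))]

theorem pair_notMem_matching {m : ℕ} {I : Finset (Mono m)} {V : Finset (Fin m)} {v k : Fin m}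
    {S : Finset (Mono m)} (hS : S ∈ matchings I ((V.erase v).erase k)) : ({k, v} : Mono m) ∉ S :=
  fun h => notMem_erase k _ (((mem_matchings.1 hS).1 _ h).2.1 (mem_insert_self _ _))

theorem weight_insert {m : ℕ} {I : Finset (Mono m)} {V : Finset (Fin m)} {v k : Fin m}
    (hv : ∀ i ∈ V, i ≤ v) (hk : k ∈ V) (hkv : k < v) {S : Finset (Mono m)}
    (hS : S ∈ matchings I ((V.erase v).erase k)) :
    weight V (insert {k, v} S) =
      2 ^ ((V.filter (· < k)).card + 1) * 2 ^ (((V.erase v).erase k).card + 1) *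
        weight ((V.erase v).erase k) S := by
  have hn := pair_notMem_matching hS
  have h : ∑ f ∈ S, lamIn V f =
      ∑ f ∈ S, lamIn ((V.erase v).erase k) f + ∑ f ∈ S, Mono.alpha {k, v} f := by
    rw [← sum_add_distrib]
    refine sum_congr rfl fun f hf => ?_
    obtain ⟨-, hf₁, hf₂⟩ := (mem_matchings.1 hS).1 f hf
    exact lamIn_erase_erase hv hk hkv hf₁ hf₂
  rw [weight, weight, alphaSum_insert hn, sum_insert hn, card_insert_of_notMem hn,
    lamIn_pair hv hkv, h]
  field_simp
  ring

/-- A matching of `V` either avoids the vertex `v` or contains exactly one edge `{k, v}`. -/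
theorem sum_matchings {m : ℕ} (I : Finset (Mono m)) {V : Finset (Fin m)} {v : Fin m} (hv : v ∈ V)
    (G : Finset (Mono m) → ℚ) :
    ∑ S ∈ matchings I V, G S = ∑ S ∈ matchings I (V.erase v), G S +
      ∑ k ∈ (V.erase v).filter (fun k => ({k, v} : Mono m) ∈ I),
        ∑ S ∈ matchings I ((V.erase v).erase k), G (insert {k, v} S) := by
  classical
  set K := (V.erase v).filter (fun k => ({k, v} : Mono m) ∈ I) with hK
  have hKm : ∀ k, k ∈ K ↔ k ≠ v ∧ k ∈ V ∧ ({k, v} : Mono m) ∈ I := fun k => by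
    simp [hK, and_assoc]
  have e₁ : (matchings I V).filter (fun S => ∀ f ∈ S, v ∉ f) = matchings I (V.erase v) := by
    ext S
    rw [mem_filter, mem_matchings, mem_matchings]
    constructor
    · rintro ⟨⟨h₁, h₂⟩, h₃⟩
      exact ⟨fun f hf => ⟨(h₁ f hf).1, subset_erase.2 ⟨(h₁ f hf).2.1, h₃ f hf⟩, (h₁ f hf).2.2⟩, h₂⟩
    · rintro ⟨h₁, h₂⟩
      exact ⟨⟨fun f hf => ⟨(h₁ f hf).1, (subset_erase.1 (h₁ f hf).2.1).1, (h₁ f hf).2.2⟩, h₂⟩,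
        fun f hf => (subset_erase.1 (h₁ f hf).2.1).2⟩
  have e₂ : (matchings I V).filter (fun S => ¬ ∀ f ∈ S, v ∉ f) =
      K.biUnion fun k => (matchings I ((V.erase v).erase k)).image (insert {k, v}) := by
    ext S
    simp only [mem_filter, mem_biUnion, mem_image, not_forall, not_not, exists_prop]
    constructor
    · rintro ⟨hS, f, hf, hvf⟩
      obtain ⟨h₁, h₂⟩ := mem_matchings.1 hS
      obtain ⟨hfI, hfV, hf2⟩ := h₁ f hf
      have hc : (f.erase v).card = 1 := by rw [card_erase_of_mem hvf, hf2]
      obtain ⟨k, hk⟩ := card_eq_one.1 hc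
      obtain rfl : f = {k, v} := by rw [← insert_erase hvf, hk, pair_comm]
      have hkv : k ≠ v := ne_of_mem_erase (hk ▸ mem_singleton_self k)
      refine ⟨k, (hKm k).2 ⟨hkv, hfV (by simp), hfI⟩, S.erase {k, v}, mem_matchings.2 ⟨?_, ?_⟩,
        insert_erase hf⟩
      · intro g hg
        obtain ⟨hgI, hgV, hg2⟩ := h₁ g (mem_of_mem_erase hg)
        have hd := h₂ g (mem_of_mem_erase hg) _ hf (ne_of_mem_erase hg)
        simp only [disjoint_insert_right, disjoint_singleton_right] at hd
        exact ⟨hgI, subset_erase.2 ⟨subset_erase.2 ⟨hgV, hd.2⟩, hd.1⟩, hg2⟩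
      · exact fun g hg g' hg' => h₂ g (mem_of_mem_erase hg) g' (mem_of_mem_erase hg')
    · rintro ⟨k, hk, T, hT, rfl⟩
      obtain ⟨hkv, hkV, hkI⟩ := (hKm k).1 hk
      obtain ⟨h₁, h₂⟩ := mem_matchings.1 hT
      have hd : ∀ f ∈ T, Disjoint {k, v} f := fun f hf => by
        have h := (h₁ f hf).2.1
        rw [subset_erase, subset_erase] at h
        simp [h.1.2, h.2]
      refine ⟨mem_matchings.2 ⟨?_, ?_⟩, {k, v}, mem_insert_self _ _, by simp⟩
      · intro f hf
        rcases mem_insert.1 hf with rfl | hf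
        · refine ⟨hkI, ?_, card_pair hkv⟩
          simp [insert_subset_iff, hkV, hv]
        · have h := h₁ f hf
          rw [subset_erase, subset_erase] at h
          exact ⟨h.1, h.2.1.1.1, h.2.2⟩
      · intro f hf g hg hfg
        rcases mem_insert.1 hf with rfl | hf <;> rcases mem_insert.1 hg with rfl | hg
        · exact absurd rfl hfg
        · exact hd g hg
        · exact (hd f hf).symm
        · exact h₂ f hf g hg hfg
  rw [← sum_filter_add_sum_filter_not _ (fun S => ∀ f ∈ S, v ∉ f), e₁, e₂, sum_biUnion]
  · congr 1
    refine sum_congr rfl fun k _ => sum_image ?_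
    intro S hS T hT hST
    rw [← erase_insert (pair_notMem_matching hS), ← erase_insert (pair_notMem_matching hT)]
    exact congrArg (fun U => U.erase {k, v}) hST
  · intro k hk k' hk' hkk'
    rw [Function.onFun, disjoint_left]
    intro S hS hS'
    obtain ⟨T, hT, rfl⟩ := mem_image.1 hS
    obtain ⟨T', hT', h⟩ := mem_image.1 hS'
    have hm : ({k, v} : Mono m) ∈ insert {k', v} T' := h ▸ mem_insert_self _ _
    rcases mem_insert.1 hm with h' | h'
    · have : k ∈ ({k', v} : Mono m) := h' ▸ mem_insert_self _ _
      rcases mem_insert.1 this with h'' | h''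
      · exact hkk' h''
      · exact ((hKm k).1 hk).1 (mem_singleton.1 h'')
    · have := ((mem_matchings.1 hT').1 _ h').2.1
      rw [subset_erase, subset_erase] at this
      exact this.1.2 (by simp)

/-! ### Distribution of the character sums -/

theorem deletion_restr {m : ℕ} (I : Finset (Mono m)) (V : Finset (Fin m)) (v : Fin m) :
    deletion v (restr I V) = restr I (V.erase v) := by
  ext f
  rw [mem_deletion, mem_restr, mem_restr, subset_erase, and_assoc]

theorem link_restr {m : ℕ} {I : Finset (Mono m)} (h₁ : ∀ f : Mono m, f.card ≤ 1 → f ∈ I)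
    (h₂ : ∀ f ∈ I, f.card ≤ 2) {V : Finset (Fin m)} {v : Fin m} (hv : v ∈ V) :
    link v (restr I V) =
      affMono ((V.erase v).filter fun k => ({k, v} : Mono m) ∈ I) := by
  ext f
  rw [mem_link, mem_restr, mem_affMono]
  constructor
  · rintro ⟨hvf, hI, hV⟩
    have hc := h₂ _ hI
    rw [card_insert_of_notMem hvf] at hc
    refine ⟨fun k hk => ?_, by omega⟩
    obtain rfl : f = {k} := eq_singleton_iff_unique_mem.2
      ⟨hk, fun j hj => card_le_one.1 (by omega) j hj k hk⟩
    rw [pair_comm] at hI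
    refine mem_filter.2 ⟨mem_erase.2 ⟨?_, hV (by simp)⟩, hI⟩
    rintro rfl
    exact hvf hk
  · rintro ⟨hK, hc⟩
    have hvf : v ∉ f := fun h => notMem_erase v V (filter_subset _ _ (hK h))
    refine ⟨hvf, ?_, insert_subset hv ((hK.trans (filter_subset _ _)).trans (erase_subset _ _))⟩
    rcases f.eq_empty_or_nonempty with rfl | ⟨k, hk⟩
    · exact h₁ _ (by simp)
    · obtain rfl : f = {k} := eq_singleton_iff_unique_mem.2
        ⟨hk, fun j hj => card_le_one.1 hc j hj k hk⟩
      rw [pair_comm]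
      exact (mem_filter.1 (hK hk)).2

theorem Mono.Decreasing.pair_mem {m : ℕ} {I : Finset (Mono m)} (hI : Mono.Decreasing I)
    {i j k v : Fin m} (hij : i ≠ j) (hkv : k < v) (h : ({k, v} : Mono m) ∈ I) (hik : i ≤ k)
    (hjv : j ≤ v) : ({i, j} : Mono m) ∈ I := by
  rcases hij.lt_or_gt with h' | h'
  · exact hI _ h _ ((pair_le_pair_iff h' hkv).2 ⟨hik, hjv⟩)
  · rw [pair_comm]
    exact hI _ h _ ((pair_le_pair_iff h' hkv).2 ⟨h'.le.trans hik, hik.trans hkv.le⟩)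

/-- If `I` contains `x_k x_v`, then it contains all `x_i x_j` with `i ≤ k`, `j ≤ v` and `i ≠ j`, and
so the product of an affine word in variables up to `x_k` and one in variables up to `x_v` lies in
the code. -/
theorem mul_mem_restr {m : ℕ} {I : Finset (Mono m)} (hI : Mono.Decreasing I)
    (h₁ : ∀ f : Mono m, f.card ≤ 1 → f ∈ I) {U W : Finset (Fin m)} {k v : Fin m} (hkv : k < v)
    (h : ({k, v} : Mono m) ∈ I) (hU : ∀ i ∈ U, i ≤ k) (hUW : U ⊆ W) (hW : ∀ i ∈ W, i ≤ v)
    {l l' : Word m} (hl : l ∈ monomialCode (affMono U)) (hl' : l' ∈ monomialCode (affMono W)) :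
    l * l' ∈ monomialCode (restr I W) := by
  have hmul : ∀ f g : Mono m, ev f.toPoly * ev g.toPoly = ev (Mono.toPoly (f ∪ g)) := by
    intro f g
    have h2 : ∀ z : ZMod 2, z = 0 ∨ z = 1 := by decide
    funext x
    rw [Pi.mul_apply, ev_toPoly_apply, ev_toPoly_apply, ev_toPoly_apply]
    by_cases hx : ∃ i ∈ f ∪ g, x i = 0
    · obtain ⟨i, hi, h0⟩ := hx
      rw [prod_eq_zero hi h0]
      rcases mem_union.1 hi with hi | hi <;> simp [prod_eq_zero hi h0]
    · push Not at hx
      have hx' : ∀ i ∈ f ∪ g, x i = 1 := fun i hi => (h2 (x i)).resolve_left (hx i hi)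
      rw [prod_eq_one hx', prod_eq_one fun i hi => hx' i (mem_union_left _ hi),
        prod_eq_one fun i hi => hx' i (mem_union_right _ hi), one_mul]
  have hfg : ∀ f ∈ affMono U, ∀ g ∈ affMono W,
      ev f.toPoly * ev g.toPoly ∈ monomialCode (restr I W) := by
    intro f hf g hg
    rw [mem_affMono] at hf hg
    rw [hmul]
    refine ev_toPoly_mem (mem_restr.2 ⟨?_, union_subset (hf.1.trans hUW) hg.1⟩)
    rcases f.eq_empty_or_nonempty with rfl | ⟨i, hi⟩
    · exact h₁ _ (by simpa using hg.2)
    rcases g.eq_empty_or_nonempty with rfl | ⟨j, hj⟩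
    · exact h₁ _ (by simpa using hf.2)
    have e₁ : f = {i} := eq_singleton_iff_unique_mem.2
      ⟨hi, fun a ha => card_le_one.1 hf.2 a ha i hi⟩
    have e₂ : g = {j} := eq_singleton_iff_unique_mem.2
      ⟨hj, fun a ha => card_le_one.1 hg.2 a ha j hj⟩
    by_cases hij : i = j
    · exact h₁ _ (by simp [e₁, e₂, hij])
    · have := hI.pair_mem hij hkv h (hU i (hf.1 hi)) (hW j (hg.1 hj))
      rw [e₁, e₂]
      exact this
  have s₁ : ∀ f ∈ affMono U, ev f.toPoly * l' ∈ monomialCode (restr I W) := fun f hf =>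
    monomialCode_le (C := (monomialCode (restr I W)).comap
      (LinearMap.mulLeft (ZMod 2) (ev f.toPoly))) (hfg f hf) hl'
  exact monomialCode_le (C := (monomialCode (restr I W)).comap
      (LinearMap.mulRight (ZMod 2) l')) s₁ hl

theorem sum_words_add {m : ℕ} {J : Finset (Mono m)} {s : Word m} (hs : s ∈ monomialCode J)
    (F : Word m → ℚ) : ∑ r ∈ words J, F (r + s) = ∑ r ∈ words J, F r := by
  refine sum_nbij' (· + s) (· - s) ?_ ?_ ?_ ?_ ?_
  · exact fun r hr => mem_words.2 (add_mem (mem_words.1 hr) hs)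
  · exact fun r hr => mem_words.2 (sub_mem (mem_words.1 hr) hs)
  · exact fun r _ => add_sub_cancel_right r s
  · exact fun r _ => sub_add_cancel r s
  · exact fun r _ => rfl

/-- The contribution of the words whose `x_v`-part has leading variable `x_k`: they are determined
by a word `r` free of `x_v` and `x_k` and two affine words, which do not affect the distribution of
the character sum. -/
theorem sum_words_pivot {m : ℕ} {I : Finset (Mono m)} (hI : Mono.Decreasing I)
    (h₁ : ∀ f : Mono m, f.card ≤ 1 → f ∈ I) (h₂ : ∀ f ∈ I, f.card ≤ 2) {V : Finset (Fin m)}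
    {v k : Fin m} (hv : ∀ i ∈ V, i ≤ v) (hk : k ∈ V) (hkv : k < v)
    (h : ({k, v} : Mono m) ∈ I) (φ : ℚ → ℚ) :
    ∑ l ∈ words (affMono (V.filter (· < k))), ∑ c ∈ words (restr I (V.erase v)),
        φ (charSum (adjoin v (adjoin k 1 l) c)) =
      2 ^ ((V.filter (· < k)).card + 1) * 2 ^ (((V.erase v).erase k).card + 1) *
        ∑ r ∈ words (restr I ((V.erase v).erase k)), φ (charSum r / 2) := by
  set W := (V.erase v).erase k with hW
  have hWm : ∀ i, i ∈ W ↔ i ≠ k ∧ i ≠ v ∧ i ∈ V := fun i => by simp [hW]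
  have hlink : link k (restr I (V.erase v)) = affMono W := by
    rw [link_restr h₁ h₂ (mem_erase.2 ⟨hkv.ne, hk⟩), filter_true_of_mem]
    intro i hi
    obtain ⟨hik, -, hiV⟩ := (hWm i).1 hi
    rw [pair_comm]
    exact hI.pair_mem hik.symm hkv h le_rfl (hv i hiV)
  have key : ∀ l ∈ words (affMono (V.filter (· < k))),
      ∑ c ∈ words (restr I (V.erase v)), φ (charSum (adjoin v (adjoin k 1 l) c)) =
        2 ^ (W.card + 1) * ∑ r ∈ words (restr I W), φ (charSum r / 2) := by
    intro l hl
    rw [mem_words] at hl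
    have hl' : ∀ l' ∈ words (affMono W), ∑ r ∈ words (restr I W),
        φ (charSum (adjoin v (adjoin k 1 l) (adjoin k l' r))) =
          ∑ r ∈ words (restr I W), φ (charSum r / 2) := by
      intro l' hl'
      rw [mem_words] at hl'
      have hUW : V.filter (· < k) ⊆ W := fun i hi => by
        obtain ⟨hi, hik⟩ := mem_filter.1 hi
        exact (hWm i).2 ⟨hik.ne, (hik.trans hkv).ne, hi⟩
      have hs := mul_mem_restr hI h₁ hkv h (fun i hi => (mem_filter.1 hi).2.le) hUW
        (fun i hi => hv i ((hWm i).1 hi).2.2) hl hl'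
      have hvW : v ∉ W := fun hh => ((hWm v).1 hh).2.1 rfl
      have hkW : k ∉ W := fun hh => ((hWm k).1 hh).1 rfl
      rw [← sum_words_add hs fun r => φ (charSum r / 2)]
      refine sum_congr rfl fun r hr => ?_
      rw [charSum_adjoin_adjoin hkv.ne' _ _ _ hl hl' (mem_words.1 hr)]
      · intro f hf
        have hf := (mem_affMono.1 hf).1.trans hUW
        exact ⟨fun hh => hvW (hf hh), fun hh => hkW (hf hh)⟩
      · intro f hf
        have hf := (mem_affMono.1 hf).1
        exact ⟨fun hh => hvW (hf hh), fun hh => hkW (hf hh)⟩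
      · intro f hf
        have hf := (mem_restr.1 hf).2
        exact ⟨fun hh => hvW (hf hh), fun hh => hkW (hf hh)⟩
    rw [sum_words_split _ k, hlink, deletion_restr, sum_congr rfl hl', sum_const, nsmul_eq_mul,
      card_words_affMono]
  rw [sum_congr rfl key, sum_const, nsmul_eq_mul, card_words_affMono, mul_assoc]

/-- The recursion for the largest index `v` of `V`: the three terms are the words with `x_v`-part `0`,
with `x_v`-part `1`, and with a non-constant `x_v`-part. -/
theorem sum_words_restr {m : ℕ} {I : Finset (Mono m)} (hI : Mono.Decreasing I)
    (h₁ : ∀ f : Mono m, f.card ≤ 1 → f ∈ I) (h₂ : ∀ f ∈ I, f.card ≤ 2) {V : Finset (Fin m)}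
    {v : Fin m} (hvV : v ∈ V) (hv : ∀ i ∈ V, i ≤ v) (φ : ℚ → ℚ) :
    ∑ c ∈ words (restr I V), φ (charSum c) =
      ∑ c ∈ words (restr I (V.erase v)), φ (charSum c) +
      ∑ _c ∈ words (restr I (V.erase v)), φ 0 +
      ∑ k ∈ (V.erase v).filter (fun k => ({k, v} : Mono m) ∈ I),
        2 ^ ((V.filter (· < k)).card + 1) * 2 ^ (((V.erase v).erase k).card + 1) *
          ∑ r ∈ words (restr I ((V.erase v).erase k)), φ (charSum r / 2) := by
  rw [sum_words_split _ v, link_restr h₁ h₂ hvV, deletion_restr, sum_words_affMono]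
  congr 1
  · congr 1
    · refine sum_congr rfl fun c _ => ?_
      congr 2
      funext x
      simp [adjoin]
    · refine sum_congr rfl fun c hc => ?_
      rw [charSum_adjoin_one _ (mem_words.1 hc)]
      intro f hf hvf
      exact notMem_erase v V ((mem_restr.1 hf).2 hvf)
  · refine sum_congr rfl fun k hk => ?_
    obtain ⟨hk, hkI⟩ := mem_filter.1 hk
    obtain ⟨hkv, hkV⟩ := mem_erase.1 hk
    have hkv : k < v := lt_of_le_of_ne (hv k hkV) hkv
    have e : ((V.erase v).filter fun i => ({i, v} : Mono m) ∈ I).filter (· < k) =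
        V.filter (· < k) := by
      ext i
      simp only [mem_filter, mem_erase]
      constructor
      · exact fun h => ⟨h.1.1.2, h.2⟩
      · exact fun h => ⟨⟨⟨(h.2.trans hkv).ne, h.1⟩,
          hI.pair_mem (h.2.trans hkv).ne hkv hkI h.2.le le_rfl⟩, h.2⟩
    rw [e, sum_words_pivot hI h₁ h₂ hv hkV hkv hkI]

/-- The distribution of the character sums: each matching `S` of `V` contributes `weight V S` words
with character sum `2 ^ (m - |S|)`, as many with its negative, and
`weight V S * (2 ^ (|V| + 1 - 2 |S|) - 2)` balanced words. -/
theorem sum_words_eq_sum_matchings {m : ℕ} {I : Finset (Mono m)} (hI : Mono.Decreasing I)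
    (h₁ : ∀ f : Mono m, f.card ≤ 1 → f ∈ I) (h₂ : ∀ f ∈ I, f.card ≤ 2) (V : Finset (Fin m))
    (φ : ℚ → ℚ) :
    ∑ c ∈ words (restr I V), φ (charSum c) =
      ∑ S ∈ matchings I V, weight V S * (φ (2 ^ m / 2 ^ S.card) + φ (-(2 ^ m / 2 ^ S.card)) +
        (2 ^ (V.card + 1) / 4 ^ S.card - 2) * φ 0) := by
  induction V using Finset.strongInduction generalizing φ with
  | H V ih =>
  rcases V.eq_empty_or_nonempty with rfl | hne
  · have e₁ : restr I ∅ = affMono ∅ := by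
      ext f
      rw [mem_restr, mem_affMono]
      constructor
      · rintro ⟨-, h⟩
        simp [subset_empty.1 h]
      · exact fun h => ⟨h₁ f h.2, h.1⟩
    have e₂ : matchings I ∅ = {∅} := by
      ext S
      rw [mem_matchings, mem_singleton]
      constructor
      · rintro ⟨h, -⟩
        refine eq_empty_of_forall_notMem fun f hf => ?_
        have := h f hf
        simp [subset_empty.1 this.2.1] at this
      · rintro rfl
        simp
    rw [e₁, e₂, words_affMono_empty, sum_pair zero_ne_one, charSum_zero, charSum_one,
      sum_singleton]
    simp [weight, Mono.alphaSum]
  · obtain ⟨v, hvV, hv⟩ : ∃ v ∈ V, ∀ i ∈ V, i ≤ v :=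
      ⟨V.max' hne, V.max'_mem hne, fun i hi => V.le_max' i hi⟩
    have hlt := erase_ssubset hvV
    have hc : (V.erase v).card + 1 = V.card := card_erase_add_one hvV
    rw [sum_words_restr hI h₁ h₂ hvV hv, sum_matchings I hvV, ih _ hlt φ, ih _ hlt fun _ => φ 0,
      ← sum_add_distrib]
    congr 1
    · refine sum_congr rfl fun S hS => ?_
      rw [weight_erase hv hS, ← hc]
      ring
    · refine sum_congr rfl fun k hk => ?_
      obtain ⟨hk, hkI⟩ := mem_filter.1 hk
      obtain ⟨hkv, hkV⟩ := mem_erase.1 hk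
      have hkv : k < v := lt_of_le_of_ne (hv k hkV) hkv
      rw [ih _ ((erase_ssubset hk).trans hlt) fun t => φ (t / 2), mul_sum]
      refine sum_congr rfl fun S hS => ?_
      have hc' : ((V.erase v).erase k).card + 1 = (V.erase v).card := card_erase_add_one hk
      rw [weight_insert hv hkV hkv hS, card_insert_of_notMem (pair_notMem_matching hS), mul_assoc,
        mul_assoc, mul_assoc, ← hc, ← hc', zero_div, neg_div, div_div, ← pow_succ]
      congr 5
      rw [pow_succ 4, pow_succ 2 (_ + 1 + 1), pow_succ 2 (_ + 1)]
      field_simp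
      ring

/-! ### Monomials in a monomial code -/

/-- The coefficient of the monomial `f` in a word, by Möbius inversion: the sum of the values at the
indicator vectors of the subsets of `f`. -/
def coeffAt {m : ℕ} (f : Mono m) : Word m →ₗ[ZMod 2] ZMod 2 where
  toFun c := ∑ T ∈ f.powerset, c fun i => if i ∈ T then 1 else 0
  map_add' _ _ := by simp [sum_add_distrib]
  map_smul' _ _ := by simp [mul_sum]

theorem coeffAt_ev {m : ℕ} (f g : Mono m) : coeffAt f (ev g.toPoly) = if g = f then 1 else 0 := by
  have h : ∀ T : Mono m, (ev g.toPoly fun i => if i ∈ T then 1 else 0) =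
      if g ⊆ T then (1 : ZMod 2) else 0 := by
    intro T
    rw [ev_toPoly_apply, prod_ite_zero]
    simp [subset_iff]
  have e : f.powerset.filter (g ⊆ ·) = Icc g f := by
    ext T
    simp [and_comm]
  change ∑ T ∈ f.powerset, _ = _
  rw [sum_congr rfl fun T _ => h T, sum_boole, e]
  by_cases hg : g ⊆ f
  · rw [card_Icc_finset hg]
    rcases eq_or_ne g f with rfl | hne
    · simp
    · have hlt := card_lt_card (hg.ssubset_of_ne hne)
      obtain ⟨d, hd⟩ : ∃ d, f.card - g.card = d + 1 := ⟨f.card - g.card - 1, by omega⟩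
      have h2 : (2 : ZMod 2) = 0 := rfl
      rw [hd, if_neg hne, Nat.cast_pow, Nat.cast_ofNat, h2, zero_pow (Nat.succ_ne_zero d)]
  · rw [Icc_eq_empty hg, if_neg]
    · simp
    · rintro rfl
      exact hg subset_rfl

theorem mem_of_ev_mem {m : ℕ} {I : Finset (Mono m)} {f : Mono m}
    (h : ev f.toPoly ∈ monomialCode I) : f ∈ I := by
  by_contra hf
  have hle : monomialCode I ≤ LinearMap.ker (coeffAt f) :=
    monomialCode_le fun g hg => by
      rw [LinearMap.mem_ker, coeffAt_ev, if_neg]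
      rintro rfl
      exact hf hg
  have := hle h
  rw [LinearMap.mem_ker, coeffAt_ev, if_pos rfl] at this
  exact one_ne_zero this

/-! ### Weight distribution -/

theorem restr_univ {m : ℕ} (I : Finset (Mono m)) : restr I univ = I := by
  simp [restr]

theorem numWeight_eq_card {m : ℕ} (I : Finset (Mono m)) (w : ℕ) :
    numWeight (monomialCode I) w = ((words I).filter fun c => hammingNorm c = w).card := by
  rw [numWeight, ← Set.ncard_coe_finset]
  congr 1
  ext c
  simp [mem_words]

theorem numWeight_eq {m : ℕ} {I : Finset (Mono m)} (hI : Mono.Decreasing I)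
    (h₁ : ∀ f : Mono m, f.card ≤ 1 → f ∈ I) (h₂ : ∀ f ∈ I, f.card ≤ 2) {w : ℕ} {t : ℚ}
    (ht : t = 2 ^ m - 2 * w) :
    (numWeight (monomialCode I) w : ℚ) =
      ∑ S ∈ matchings I univ, weight univ S *
        ((if 2 ^ m / 2 ^ S.card = t then 1 else 0) + (if -(2 ^ m / 2 ^ S.card) = t then 1 else 0) +
          (2 ^ (m + 1) / 4 ^ S.card - 2) * if 0 = t then 1 else 0) := by
  have := sum_words_eq_sum_matchings hI h₁ h₂ univ fun s => if s = t then 1 else 0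
  rw [restr_univ, card_univ, Fintype.card_fin] at this
  rw [← this, sum_boole, numWeight_eq_card]
  congr 2
  refine filter_congr fun c _ => ?_
  rw [charSum_eq, ht, sub_right_inj, mul_right_inj' two_ne_zero, Nat.cast_inj]

theorem coprimeTuples_eq {m : ℕ} (I : Finset (Mono m)) (μ : ℕ) :
    Mono.coprimeTuples I μ = (matchings I univ).filter (·.card = μ) := by
  ext S
  simp only [Mono.coprimeTuples, matchings, restr_univ, mem_filter, mem_powersetCard, mem_powerset]
  tauto

theorem numWeight_eq_of_pos {m : ℕ} {I : Finset (Mono m)} (hI : Mono.Decreasing I)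
    (h₁ : ∀ f : Mono m, f.card ≤ 1 → f ∈ I) (h₂ : ∀ f ∈ I, f.card ≤ 2) {w μ : ℕ}
    (ht : (2 ^ m - 2 * w : ℚ) = 2 ^ m / 2 ^ μ ∨ (2 ^ m - 2 * w : ℚ) = -(2 ^ m / 2 ^ μ)) :
    (numWeight (monomialCode I) w : ℚ) = ∑ S ∈ Mono.coprimeTuples I μ,
      (2 : ℚ) ^ (2 * μ + ∑ f ∈ S, f.lam) / 2 ^ Mono.alphaSum S := by
  have hp : ∀ s : ℕ, (0 : ℚ) < 2 ^ m / 2 ^ s := fun s => by positivity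
  have hinj : ∀ s : ℕ, (2 ^ m / 2 ^ s : ℚ) = 2 ^ m / 2 ^ μ ↔ s = μ := fun s => by
    rw [div_eq_mul_inv, div_eq_mul_inv, mul_right_inj' (by positivity), inv_inj]
    exact pow_right_inj₀ two_pos (by norm_num)
  have hne : ∀ s : ℕ, (2 ^ m / 2 ^ s : ℚ) ≠ -(2 ^ m / 2 ^ μ) := fun s h => by
    linarith [hp s, hp μ]
  have hne' : ∀ s : ℕ, -(2 ^ m / 2 ^ s : ℚ) ≠ 2 ^ m / 2 ^ μ := fun s h => by
    linarith [hp s, hp μ]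
  rw [coprimeTuples_eq, sum_filter]
  rcases ht with ht | ht <;> rw [numWeight_eq hI h₁ h₂ ht.symm] <;>
    refine sum_congr rfl fun S _ => ?_
  · rw [if_neg (hne' _), if_neg (hp μ).ne, if_congr (hinj _) rfl rfl]
    split_ifs with h
    · rw [weight, h]
      simp [lamIn_univ]
    · simp
  · rw [if_neg (hne _), if_neg (neg_lt_zero.2 (hp μ)).ne', if_congr (neg_inj.trans (hinj _)) rfl rfl]
    split_ifs with h
    · rw [weight, h]
      simp [lamIn_univ]
    · simp

theorem card_prod_of_mem_matchings {m : ℕ} {I : Finset (Mono m)} {V : Finset (Fin m)}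
    {S : Finset (Mono m)} (hS : S ∈ matchings I V) : (Mono.prod S).card = 2 * S.card := by
  obtain ⟨h₁, h₂⟩ := mem_matchings.1 hS
  have hd : (S : Set (Mono m)).PairwiseDisjoint id := fun f hf g hg hfg => h₂ f hf g hg hfg
  have hc : ∀ f ∈ S, (id f).card = 2 := fun f hf => (h₁ f hf).2.2
  rw [Mono.prod, card_biUnion hd, sum_congr rfl hc, sum_const, smul_eq_mul, mul_comm]

theorem two_mul_card_le {m : ℕ} {I : Finset (Mono m)} {V : Finset (Fin m)}
    {S : Finset (Mono m)} (hS : S ∈ matchings I V) : 2 * S.card ≤ m := by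
  rw [← card_prod_of_mem_matchings hS]
  exact (card_le_univ _).trans_eq (Fintype.card_fin m)

theorem numWeight_eq_zero {m : ℕ} {I : Finset (Mono m)} (hI : Mono.Decreasing I)
    (h₁ : ∀ f : Mono m, f.card ≤ 1 → f ∈ I) (h₂ : ∀ f ∈ I, f.card ≤ 2) {w : ℕ}
    (h0 : (2 ^ m - 2 * w : ℚ) ≠ 0)
    (h : ∀ μ : ℕ, 2 * μ ≤ m → (2 ^ m - 2 * w : ℚ) ≠ 2 ^ m / 2 ^ μ ∧
      (2 ^ m - 2 * w : ℚ) ≠ -(2 ^ m / 2 ^ μ)) :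
    numWeight (monomialCode I) w = 0 := by
  rw [← Nat.cast_eq_zero (R := ℚ), numWeight_eq hI h₁ h₂ rfl]
  refine sum_eq_zero fun S hS => ?_
  obtain ⟨hs, hs'⟩ := h _ (two_mul_card_le hS)
  simp [hs.symm, hs'.symm, h0.symm]

theorem sum_two_pow_card_lt {m : ℕ} (U : Finset (Fin m)) :
    ∑ j ∈ U, (2 : ℚ) ^ (U.filter (· < j)).card = 2 ^ U.card - 1 := by
  induction U using Finset.induction_on_max with
  | empty => simp
  | insert k K hK ih =>
    have hk : k ∉ K := fun h => lt_irrefl _ (hK k h)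
    have h₁ : (insert k K).filter (· < k) = K := by
      rw [filter_insert, if_neg (lt_irrefl k), filter_true_of_mem hK]
    have h₂ : ∑ j ∈ K, (2 : ℚ) ^ ((insert k K).filter (· < j)).card =
        ∑ j ∈ K, (2 : ℚ) ^ (K.filter (· < j)).card :=
      sum_congr rfl fun j hj => by rw [filter_insert, if_neg (hK j hj).not_gt]
    rw [sum_insert hk, h₁, h₂, ih, card_insert_of_notMem hk]
    ring

/-- As `x_j` runs over the variables coprime to a matching `S`, the number `λ(x_j)` runs over
`0, …, m - 1 - 2 |S|`, so that the sum over `x_j` is a geometric sum; up to the factor `weight` it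
equals the number of balanced words in `sum_words_eq_sum_matchings`. -/
theorem sum_variable_eq {m : ℕ} {I : Finset (Mono m)} {S : Finset (Mono m)}
    (hS : S ∈ matchings I univ) :
    ∑ j ∈ univ.filter (fun j : Fin m => ∀ f ∈ S, j ∉ f),
        (2 : ℚ) ^ (2 * S.card + (∑ f ∈ S, f.lam) + 1 + (Mono.prod S).lamVar j) /
          2 ^ Mono.alphaSum S =
      weight univ S * (2 ^ (m + 1) / 4 ^ S.card - 2) := by
  set U := univ.filter (fun j : Fin m => ∀ f ∈ S, j ∉ f) with hU
  have hc : 2 * S.card + U.card = m := by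
    have e : U = (Mono.prod S)ᶜ := by
      ext j
      simp [hU, Mono.prod]
    rw [e, ← card_prod_of_mem_matchings hS, card_add_card_compl, Fintype.card_fin]
  have hl : ∀ j, (Mono.prod S).lamVar j = (U.filter (· < j)).card := fun j => by
    rw [Mono.lamVar]
    congr 1
    ext i
    have hi : i ∉ Mono.prod S ↔ ∀ f ∈ S, i ∉ f := by simp [Mono.prod]
    simp only [hU, mem_filter, mem_univ, true_and, hi, and_comm]
  have e : ∀ j ∈ U, (2 : ℚ) ^ (2 * S.card + (∑ f ∈ S, f.lam) + 1 + (Mono.prod S).lamVar j) /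
      2 ^ Mono.alphaSum S = weight univ S * 2 * 2 ^ (U.filter (· < j)).card := fun j _ => by
    rw [hl, weight, pow_add, pow_succ, sum_congr rfl fun f _ => lamIn_univ f]
    ring
  have h4 : (2 : ℚ) ^ (m + 1) / 4 ^ S.card = 2 * 2 ^ U.card := by
    have h4' : (4 : ℚ) ^ S.card = 2 ^ (2 * S.card) := by
      rw [pow_mul]
      norm_num
    rw [div_eq_iff (by positivity), h4', mul_assoc, ← pow_add, add_comm U.card, hc, pow_succ']
  rw [sum_congr rfl e, ← mul_sum, sum_two_pow_card_lt, h4]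
  ring

theorem numWeight_middle {m : ℕ} (hm : 2 ≤ m) {I : Finset (Mono m)} (hI : Mono.Decreasing I)
    (h₁ : ∀ f : Mono m, f.card ≤ 1 → f ∈ I) (h₂ : ∀ f ∈ I, f.card ≤ 2) :
    (numWeight (monomialCode I) (2 ^ (m - 1)) : ℚ) =
      ∑ l ∈ range ((m - 1) / 2 + 1), ∑ S ∈ Mono.coprimeTuples I l,
        ∑ j ∈ univ.filter (fun j : Fin m => ∀ f ∈ S, j ∉ f),
          (2 : ℚ) ^ (2 * l + (∑ f ∈ S, f.lam) + 1 + (Mono.prod S).lamVar j) /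
            2 ^ Mono.alphaSum S := by
  have ht : (0 : ℚ) = 2 ^ m - 2 * (2 ^ (m - 1) : ℕ) := by
    obtain ⟨n, rfl⟩ : ∃ n, m = n + 1 := ⟨m - 1, by omega⟩
    push_cast [Nat.add_sub_cancel]
    ring
  have e : ∀ l, ∑ S ∈ Mono.coprimeTuples I l,
        ∑ j ∈ univ.filter (fun j : Fin m => ∀ f ∈ S, j ∉ f),
          (2 : ℚ) ^ (2 * l + (∑ f ∈ S, f.lam) + 1 + (Mono.prod S).lamVar j) /
            2 ^ Mono.alphaSum S =
      ∑ S ∈ matchings I univ with S.card = l,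
        weight univ S * (2 ^ (m + 1) / 4 ^ S.card - 2) := fun l => by
    rw [coprimeTuples_eq]
    refine sum_congr rfl fun S hS => ?_
    obtain ⟨hS', hl⟩ := mem_filter.1 hS
    rw [← hl]
    exact sum_variable_eq hS'
  -- For even `m` the perfect matchings, which admit no further variable, contribute zero.
  rw [sum_congr rfl fun l _ => e l, sum_subset (s₂ := range (m + 1)) (range_subset_range.2 (by omega)),
    sum_fiberwise_of_maps_to, numWeight_eq hI h₁ h₂ ht]
  · refine sum_congr rfl fun S _ => ?_
    simp
  · intro S hS
    have := two_mul_card_le hS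
    exact mem_range.2 (by omega)
  · intro l _ hl
    refine sum_eq_zero fun S hS => ?_
    obtain ⟨hS', hSl⟩ := mem_filter.1 hS
    have hle := two_mul_card_le hS'
    have hlt : (m - 1) / 2 + 1 ≤ l := not_lt.1 fun h => hl (mem_range.2 h)
    have hS2 : 2 * S.card = m := by omega
    have h4 : (4 : ℚ) ^ S.card = 2 ^ m := by
      rw [← congrArg ((2 : ℚ) ^ ·) hS2, pow_mul]
      norm_num
    rw [h4, pow_succ', mul_div_cancel_right₀ _ (by positivity), sub_self, mul_zero]

theorem mainTheorem2 (m : ℕ) (hm : 2 ≤ m) (I : Finset (Mono m)) (hI : Mono.Decreasing I)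
    (h₁ : reedMuller 1 m ≤ monomialCode I) (h₂ : monomialCode I ≤ reedMuller 2 m) :
    -- weights `0` and `2 ^ m`
    numWeight (monomialCode I) 0 = 1 ∧
    numWeight (monomialCode I) (2 ^ m) = 1 ∧
    -- weights `2 ^ (m - 2)` and `2 ^ m - 2 ^ (m - 2)`
    numWeight (monomialCode I) (2 ^ (m - 2)) =
      ∑ f ∈ Mono.ofDegree I 2, 2 ^ (2 + f.lam) ∧
    numWeight (monomialCode I) (2 ^ m - 2 ^ (m - 2)) =
      ∑ f ∈ Mono.ofDegree I 2, 2 ^ (2 + f.lam) ∧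
    -- weights `2 ^ (m - 1) ± 2 ^ (m - 1 - μ)`
    (∀ μ : ℕ, 1 ≤ μ → 2 * μ ≤ m →
      (numWeight (monomialCode I) (2 ^ (m - 1) - 2 ^ (m - 1 - μ)) : ℚ) =
        ∑ S ∈ Mono.coprimeTuples I μ,
          (2 : ℚ) ^ (2 * μ + ∑ f ∈ S, f.lam) / 2 ^ Mono.alphaSum S ∧
      (numWeight (monomialCode I) (2 ^ (m - 1) + 2 ^ (m - 1 - μ)) : ℚ) =
        ∑ S ∈ Mono.coprimeTuples I μ,
          (2 : ℚ) ^ (2 * μ + ∑ f ∈ S, f.lam) / 2 ^ Mono.alphaSum S) ∧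
    -- weight `2 ^ (m - 1)`, which is twice the minimum distance unless the code is `R(1, m)`
    (numWeight (monomialCode I) (2 ^ (m - 1)) : ℚ) =
      ∑ l ∈ Finset.range ((m - 1) / 2 + 1), ∑ S ∈ Mono.coprimeTuples I l,
        ∑ j ∈ Finset.univ.filter (fun j : Fin m => ∀ f ∈ S, j ∉ f),
          (2 : ℚ) ^ (2 * l + (∑ f ∈ S, f.lam) + 1 + (Mono.prod S).lamVar j) /
            2 ^ Mono.alphaSum S ∧
    (monomialCode I ≠ reedMuller 1 m →
      2 ^ (m - 1) = 2 * minDistance (monomialCode I)) ∧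
    -- no other weights occur
    (∀ w : ℕ, w ≠ 0 → w ≠ 2 ^ m → w ≠ 2 ^ (m - 1) →
      (∀ μ : ℕ, 1 ≤ μ → 2 * μ ≤ m →
        w ≠ 2 ^ (m - 1) - 2 ^ (m - 1 - μ) ∧ w ≠ 2 ^ (m - 1) + 2 ^ (m - 1 - μ)) →
      numWeight (monomialCode I) w = 0) := by
  have hlow : ∀ f : Mono m, f.card ≤ 1 → f ∈ I := fun f hf =>
    mem_of_ev_mem (h₁ (ev_toPoly_mem (by simpa using hf)))
  have hhigh : ∀ f ∈ I, f.card ≤ 2 := fun f hf => by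
    simpa using mem_of_ev_mem (h₂ (ev_toPoly_mem hf))
  have hsub : ∀ μ, ((2 ^ (m - 1) - 2 ^ (m - 1 - μ) : ℕ) : ℚ) =
      2 ^ (m - 1) - 2 ^ (m - 1 - μ) := fun μ => by
    rw [Nat.cast_sub (Nat.pow_le_pow_right two_pos (by omega))]
    push_cast
    rfl
  have hdiv : ∀ μ, 2 * μ ≤ m → (2 ^ m / 2 ^ μ : ℚ) = 2 * 2 ^ (m - 1 - μ) := fun μ hμ => by
    rw [div_eq_iff (by positivity), ← pow_succ', ← pow_add]
    congr 1
    omega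
  have hhalf : (2 ^ m : ℚ) = 2 * 2 ^ (m - 1) := by
    rw [← pow_succ']
    congr 1
    omega
  have hminus : ∀ μ, 2 * μ ≤ m →
      (2 ^ m - 2 * ((2 ^ (m - 1) - 2 ^ (m - 1 - μ) : ℕ) : ℚ)) = 2 ^ m / 2 ^ μ := fun μ hμ => by
    rw [hsub μ, hdiv μ hμ, hhalf]
    ring
  have hplus : ∀ μ, 2 * μ ≤ m →
      (2 ^ m - 2 * ((2 ^ (m - 1) + 2 ^ (m - 1 - μ) : ℕ) : ℚ)) = -(2 ^ m / 2 ^ μ) := fun μ hμ => by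
    rw [hdiv μ hμ, hhalf]
    push_cast
    ring
  have hzero : ∑ S ∈ Mono.coprimeTuples I 0,
      (2 : ℚ) ^ (2 * 0 + ∑ f ∈ S, f.lam) / 2 ^ Mono.alphaSum S = 1 := by
    have : Mono.coprimeTuples I 0 = {∅} := by
      ext S
      simp only [Mono.coprimeTuples, powersetCard_zero, mem_filter, mem_singleton]
      constructor
      · exact fun h => h.1
      · rintro rfl
        simp
    rw [this, sum_singleton]
    simp [Mono.alphaSum]
  have hone : ∑ S ∈ Mono.coprimeTuples I 1,
      (2 : ℚ) ^ (2 * 1 + ∑ f ∈ S, f.lam) / 2 ^ Mono.alphaSum S =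
        ((∑ f ∈ Mono.ofDegree I 2, 2 ^ (2 + f.lam) : ℕ) : ℚ) := by
    have h : Mono.coprimeTuples I 1 = (Mono.ofDegree I 2).map ⟨singleton, singleton_injective⟩ := by
      rw [Mono.coprimeTuples, powersetCard_one, filter_true_of_mem]
      intro S hS f hf g hg hfg
      obtain ⟨f', -, rfl⟩ := mem_map.1 hS
      exact absurd ((mem_singleton.1 hf).trans (mem_singleton.1 hg).symm) hfg
    rw [h, sum_map]
    push_cast
    refine sum_congr rfl fun f _ => ?_
    simp [Mono.alphaSum, filter_singleton]
  have hquarter : 2 ^ (m - 1) - 2 ^ (m - 1 - 1) = 2 ^ (m - 2) ∧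
      2 ^ (m - 1) + 2 ^ (m - 1 - 1) = 2 ^ m - 2 ^ (m - 2) ∧ 2 ^ (m - 1) = 2 * 2 ^ (m - 2) ∧
      2 ^ m = 4 * 2 ^ (m - 2) := by
    obtain ⟨n, rfl⟩ : ∃ n, m = n + 2 := ⟨m - 2, by omega⟩
    simp only [Nat.add_sub_cancel, show n + 2 - 1 = n + 1 by omega, pow_succ]
    omega
  obtain ⟨hq₁, hq₂, hq₃, hq₄⟩ := hquarter
  have hweights : ∀ μ : ℕ, 1 ≤ μ → 2 * μ ≤ m →
      (numWeight (monomialCode I) (2 ^ (m - 1) - 2 ^ (m - 1 - μ)) : ℚ) =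
        ∑ S ∈ Mono.coprimeTuples I μ,
          (2 : ℚ) ^ (2 * μ + ∑ f ∈ S, f.lam) / 2 ^ Mono.alphaSum S ∧
      (numWeight (monomialCode I) (2 ^ (m - 1) + 2 ^ (m - 1 - μ)) : ℚ) =
        ∑ S ∈ Mono.coprimeTuples I μ,
          (2 : ℚ) ^ (2 * μ + ∑ f ∈ S, f.lam) / 2 ^ Mono.alphaSum S := fun μ _ hμ =>
    ⟨numWeight_eq_of_pos hI hlow hhigh (Or.inl (hminus μ hμ)),
      numWeight_eq_of_pos hI hlow hhigh (Or.inr (hplus μ hμ))⟩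
  have hmin : numWeight (monomialCode I) (2 ^ (m - 2)) =
      ∑ f ∈ Mono.ofDegree I 2, 2 ^ (2 + f.lam) := by
    have := (hweights 1 le_rfl hm).1
    rw [hone, hq₁] at this
    exact_mod_cast this
  have hother : ∀ w : ℕ, w ≠ 0 → w ≠ 2 ^ m → w ≠ 2 ^ (m - 1) →
      (∀ μ : ℕ, 1 ≤ μ → 2 * μ ≤ m →
        w ≠ 2 ^ (m - 1) - 2 ^ (m - 1 - μ) ∧ w ≠ 2 ^ (m - 1) + 2 ^ (m - 1 - μ)) →
      numWeight (monomialCode I) w = 0 := by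
    intro w hw₀ hw₁ hw₂ hw
    refine numWeight_eq_zero hI hlow hhigh ?_ fun μ hμ => ?_
    · intro h
      apply hw₂
      have : (w : ℚ) = (2 ^ (m - 1) : ℕ) := by
        push_cast
        linarith
      exact_mod_cast this
    · rw [← hminus μ hμ, Ne, Ne, sub_right_inj, mul_right_inj' two_ne_zero, Nat.cast_inj,
        hminus μ hμ, ← hplus μ hμ, sub_right_inj, mul_right_inj' two_ne_zero, Nat.cast_inj]
      rcases Nat.eq_zero_or_pos μ with rfl | hpos
      · rw [Nat.sub_zero, Nat.sub_self]
        exact ⟨hw₀, by omega⟩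
      · exact hw μ hpos hμ
  refine ⟨?_, ?_, hmin, ?_, hweights, numWeight_middle hm hI hlow hhigh, ?_, hother⟩
  · have := numWeight_eq_of_pos hI hlow hhigh (w := 0) (μ := 0) (Or.inl (by simp))
    rw [hzero] at this
    exact_mod_cast this
  · have := numWeight_eq_of_pos hI hlow hhigh (w := 2 ^ m) (μ := 0)
      (Or.inr (by push_cast; rw [pow_zero]; ring))
    rw [hzero] at this
    exact_mod_cast this
  · have := (hweights 1 le_rfl hm).2
    rw [hone, hq₂] at this
    exact_mod_cast this
  · intro hne
    rw [hq₃]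
    congr 1
    -- A code other than `R(1, m)` has a monomial of degree two, hence a word of weight `2 ^ (m - 2)`.
    obtain ⟨f, hf, hf2⟩ : ∃ f ∈ I, f.card = 2 := by
      by_contra! h
      refine hne (le_antisymm (monomialCode_le fun f hf => ev_toPoly_mem ?_) h₁)
      have := hhigh f hf
      have := h f hf
      exact mem_filter.2 ⟨mem_univ _, by omega⟩
    have hpos : 0 < numWeight (monomialCode I) (2 ^ (m - 2)) := by
      rw [hmin]
      exact sum_pos (fun _ _ => by positivity) ⟨f, mem_filter.2 ⟨hf, hf2⟩⟩
    obtain ⟨c, hc, hcw⟩ := Set.nonempty_of_ncard_ne_zero hpos.ne'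
    have hmem : 2 ^ (m - 2) ∈ {d | ∃ c ∈ monomialCode I, ∃ c' ∈ monomialCode I,
        c ≠ c' ∧ hammingDist c c' = d} := by
      refine ⟨c, hc, 0, zero_mem _, ?_, by rw [hammingDist_zero_right, hcw]⟩
      rintro rfl
      rw [hammingNorm_zero] at hcw
      exact (pow_pos two_pos _).ne hcw
    refine le_antisymm (le_csInf ⟨_, hmem⟩ ?_) (csInf_le' hmem)
    rintro d ⟨c, hc, c', hc', hcc', rfl⟩
    rw [hammingDist_eq_hammingNorm]
    by_contra! hlt
    have hd : -c + c' ∈ monomialCode I := add_mem (neg_mem hc) hc'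
    have hz := hother (hammingNorm (-c + c')) (by simpa [neg_add_eq_zero] using hcc') (by omega)
      (by omega) fun μ hμ _ => by
        have : 2 ^ (m - 1 - μ) ≤ 2 ^ (m - 2) := Nat.pow_le_pow_right two_pos (by omega)
        have := Nat.two_pow_pos (m - 1 - μ)
        omega
    rw [numWeight_eq_card, card_eq_zero] at hz
    exact filter_eq_empty_iff.1 hz (mem_words.2 hd) rfl
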